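/- Let $H$ be a real Hilbert space and let $F:H\to H$ be monotone, i.e. $\langle F(u)-F(v),u-v\rangle\ge 0$ for all $u,v\in H$, and twice Fréchet differentiable, with $\sup_{\|u-x\|\le R}\|F^{(j)}(u)\|\le M_j(x,R)<\infty$ for $0\le j\le 2$ and all $x\in H$, $R>0$. Suppose that $F(u)=f$ is solvable and that its minimal-norm solution $y$ is nonzero. Let $a(t)=d/(c+t)^b$ with constants $0<b\le 1$, $c>6b$, $d>0$, and let $C_1>1$, $0<\zeta\le 1$, $0<\delta_0\le 1$. For every $\delta\in(0,\delta_0)$ let $f_\delta\in H$ with $\|f_\delta-f\|\le\delta$ and an initial point $u_0\in H$ (which may depend on $\delta$) be given. Let $V_\delta(0)$ be the unique solution of $F(V)+a(0)V=f_\delta$, and set $C=(C_1+1)/2$ and $c_1=\|y\|\bigl(1+\tfrac1{C-1}\bigr)$. Assume that the following hold for every $\delta\in(0,\delta_0)$. 1. ($d$ is large.) There are $R>0$ and $\lambda>0$ such that, with $c_0=\tfrac12M_2(u_0,R)$, for all $t\ge0$, $$\frac{c_0}{a(t)}\le\frac{\lambda}{2a(t)}\Bigl[1-\frac{|\dot a(t)|}{a(t)}\Bigr],\qquad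 c_1\frac{|\dot a(t)|}{a(t)}\le\frac{a(t)}{2\lambda}\Bigl[1-\frac{|\dot a(t)|}{a(t)}\Bigr],\qquad \|F(0)-f_\delta\|\le\frac{a(0)^2}{\lambda}.$$ 2. ($u_0$ is close to $V_\delta(0)$.) $$\|u_0-V_\delta(0)\|\le\frac{\|F(0)-f_\delta\|}{a(0)},\qquad \|F(u_0)+a(0)u_0-f_\delta\|\le\tfrac14a(0)\|V_\delta(0)\|.$$ 3. $\|F(u_0)-f_\delta\|>C_1\delta^\zeta$. Then for every $\delta\in(0,\delta_0)$ there is $T_\delta>0$ such that the Cauchy problem $$\dot u_\delta=-\bigl(F'(u_\delta)+a(t)I\bigr)^{-1}\bigl(F(u_\delta)+a(t)u_\delta-f_\delta\bigr),\qquad u_\delta(0)=u_0,$$ has a unique solution $u_\delta$ on $[0,T_\delta]$ (the inverse existing as a bounded operator along it), and there is a unique $t_\delta\in(0,T_\delta)$ with $$\|F(u_\delta(t_\delta))-f_\delta\|=C_1\delta^\zeta,\qquad \|F(u_\delta(t))-f_\delta\|>C_1\delta^\zeta\quad\text{for all }t\in[0,t_\delta).$$ Moreover $T_\delta\to\infty$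 and $t_\delta\to\infty$ as $\delta\to0$, and if $\zeta\in(0,1)$, then $\lim_{\delta\to0}\|u_\delta(t_\delta)-y\|=0$. -/

import Mathlib

open Filter Topology Set

noncomputable section

/-- The regularizing function `a(t) = d / (c + t) ^ b`. -/
def gain (b c d : ℝ) (t : ℝ) : ℝ := d / (c + t) ^ b

section

variable {H : Type*} [NormedAddCommGroup H] [InnerProductSpace ℝ H]

/-- `F` is monotone: `⟨F u - F v, u - v⟩ ≥ 0` for all `u`, `v`. -/
def IsMonotoneOperator (F : H → H) : Prop :=
  ∀ u v : H, 0 ≤ inner ℝ (F u - F v) (u - v)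

/-- `F` is twice Fréchet differentiable on `H` (the second derivative need not be continuous). -/
def TwiceFrechetDifferentiable (F : H → H) : Prop :=
  Differentiable ℝ F ∧ Differentiable ℝ (fderiv ℝ F)

/-- The derivatives of `F` of order `0`, `1`, `2` are bounded on every closed ball `B(x, R)`,
by the constants `M j x R`. -/
def DerivativesBoundedOnBalls (F : H → H) (M : ℕ → H → ℝ → ℝ) : Prop :=
  ∀ j ≤ 2, ∀ x : H, ∀ R > 0, ∀ u : H, ‖u - x‖ ≤ R → ‖iteratedFDeriv ℝ j F u‖ ≤ M j x R

/-- `y` is a solution of `F u = f` of minimal norm. -/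
def IsMinimalNormSolution (F : H → H) (f y : H) : Prop :=
  F y = f ∧ ∀ u : H, F u = f → ‖y‖ ≤ ‖u‖

/-- The three conditions expressing that the function `a` is large enough relative to the
constants `c₀`, `c₁`, the data `g` and the auxiliary constant `l > 0`. -/
def LargeGain (F : H → H) (a : ℝ → ℝ) (g : H) (c₀ c₁ l : ℝ) : Prop :=
  (∀ t, 0 ≤ t → c₀ / a t ≤ l / (2 * a t) * (1 - |deriv a t| / a t)) ∧
  (∀ t, 0 ≤ t → c₁ * (|deriv a t| / a t) ≤ a t / (2 * l) * (1 - |deriv a t| / a t)) ∧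
  ‖F 0 - g‖ ≤ a 0 ^ 2 / l

/-- The closeness conditions on the initial point `u₀`. Here `V` is the solution, unique for
monotone continuous `F`, of the regularized equation `F V + a(0) V = g`. -/
def InitialPointClose (F : H → H) (a : ℝ → ℝ) (g u₀ : H) : Prop :=
  ∀ V : H, F V + a 0 • V - g = 0 →
    ‖u₀ - V‖ ≤ ‖F 0 - g‖ / a 0 ∧ ‖F u₀ + a 0 • u₀ - g‖ ≤ 1 / 4 * a 0 * ‖V‖

/-- `u` solves, on `[0, T]`, the Cauchy problem
`u' = -(F'(u) + a(t) I)⁻¹ (F(u) + a(t) u - g)`, `u(0) = u₀`. It is part of the definition that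
the operator being inverted has a bounded inverse; derivatives at the endpoints are one-sided. -/
def IsDSMSolution (F : H → H) (a : ℝ → ℝ) (g u₀ : H) (T : ℝ) (u : ℝ → H) : Prop :=
  u 0 = u₀ ∧
  ∀ t ∈ Icc 0 T,
    (fderiv ℝ F (u t) + a t • ContinuousLinearMap.id ℝ H).IsInvertible ∧
    HasDerivWithinAt u
      (-((fderiv ℝ F (u t) + a t • ContinuousLinearMap.id ℝ H).inverse
          (F (u t) + a t • u t - g)))
      (Icc 0 T) t

/-- `s` is the first time at which the discrepancy `‖F(u(t)) - g‖` comes down to `level`. -/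
def IsStoppingTimeDP (F : H → H) (g : H) (level : ℝ) (u : ℝ → H) (s : ℝ) : Prop :=
  ‖F (u s) - g‖ = level ∧ ∀ t ∈ Ico 0 s, level < ‖F (u t) - g‖

end

end

/-!
Write `a` for the gain, `g` for the noisy data and `V(t)` for the solution of
`F V + a(t) V = g`. For monotone `F`, Lipschitz on balls, `V(t)` exists and is unique
(`IsMonotoneOperator.exists_add_smul_eq`): a small step along the residual contracts a large ball
into itself.

Everything rests on the residual `w = F u + a u - g` along the flow. The Newton-type equation is
equivalent to `w' = -w + a' u` with `u = (F + a I)⁻¹ (g + w)`, and there the perturbation is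
Lipschitz in `w` with constant `|a'| / a ≤ b / c < 1`. Hence solutions exist on every interval
`[0, T]` (`exists_hasDerivWithinAt_neg_add`, `IsRegularizable.exists_isDSMSolution`) and are unique
(`IsDSMSolution.eqOn`). Since `‖u - V‖ ≤ ‖w‖ / a` and `‖V‖` grows with time, a barrier argument
gives `‖w(t)‖ ≤ (c / (c + t)) ^ p * a(t) * ‖V(t)‖ / 4` for a small `p > 0`
(`IsDSMSolution.norm_residual_le`); the inequality `6 * b < c` and the condition on
`‖F u₀ + a(0) u₀ - g‖` are exactly what it needs.

So the discrepancy `‖F u - g‖` differs from `a ‖V‖` by at most the fraction `1 / 4` of it, and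
asymptotically by nothing. As `a ‖V‖ ≤ a ‖y‖ + δ`, the discrepancy comes down to any level above
`δ`, in particular to `C₁ * δ ^ ζ`. At the stopping time `a ‖V‖` is comparable with `δ ^ ζ`, and
`‖V‖` is bounded below because `F 0 ≠ f`; therefore `a → 0` and the stopping time tends to
infinity. If `ζ < 1`, then `a` is bounded below by a multiple of `δ ^ ζ`, so `δ / a → 0`, and the
three terms in `‖u - y‖ ≤ ‖u - V‖ + ‖V - V₀‖ + ‖V₀ - y‖`, with `V₀` the regularized solution for
exact data, tend to zero by the barrier estimate, by strong monotonicity (`δ / a`), and by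
`IsRegularizable.tendsto_regSol`.
-/

/-! ### The regularized equation for a monotone operator -/

section Resolvent

variable {H : Type*} [NormedAddCommGroup H] [InnerProductSpace ℝ H]

/-- `F` is Lipschitz on every ball centred at the origin. -/
def LipschitzOnBalls (F : H → H) : Prop :=
  ∀ r : ℝ, ∃ L : ℝ, ∀ u v : H, ‖u‖ ≤ r → ‖v‖ ≤ r → ‖F u - F v‖ ≤ L * ‖u - v‖

lemma DerivativesBoundedOnBalls.lipschitzOnBalls {F : H → H} {M : ℕ → H → ℝ → ℝ}
    (hM : DerivativesBoundedOnBalls F M) (hF : Differentiable ℝ F) : LipschitzOnBalls F := by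
  intro r
  refine ⟨M 1 0 (max r 1), fun u v hu hv => ?_⟩
  refine Convex.norm_image_sub_le_of_norm_fderiv_le (𝕜 := ℝ) (s := Metric.closedBall 0 (max r 1))
    (fun x _ => hF x) (fun x hx => ?_) (convex_closedBall _ _) ?_ ?_
  · rw [← norm_iteratedFDeriv_one]
    exact hM 1 (by norm_num) 0 _ (lt_max_of_lt_right one_pos) x (by simpa using hx)
  · simpa using Or.inl hv
  · simpa using Or.inl hu

/-- A monotone operator plus a positive multiple of the identity is strongly monotone. -/
lemma IsMonotoneOperator.le_inner_add_smul {F : H → H} (hF : IsMonotoneOperator F) (a : ℝ)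
    (u v : H) : a * ‖u - v‖ ^ 2 ≤ inner ℝ ((F u + a • u) - (F v + a • v)) (u - v) := by
  have h := hF u v
  have e : (F u + a • u) - (F v + a • v) = (F u - F v) + a • (u - v) := by
    rw [smul_sub]; abel
  rw [e, inner_add_left, real_inner_smul_left, real_inner_self_eq_norm_sq]
  linarith

lemma IsMonotoneOperator.norm_add_smul_sub_sq {F : H → H} (hF : IsMonotoneOperator F) {a : ℝ}
    (ha : 0 ≤ a) (u v : H) :
    ‖F u - F v‖ ^ 2 + (a * ‖u - v‖) ^ 2 ≤ ‖(F u + a • u) - (F v + a • v)‖ ^ 2 := by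
  have h := hF u v
  have e : (F u + a • u) - (F v + a • v) = (F u - F v) + a • (u - v) := by
    rw [smul_sub]; abel
  rw [e, norm_add_sq_real, real_inner_smul_right, norm_smul, Real.norm_eq_abs, abs_of_nonneg ha]
  nlinarith [mul_nonneg ha h]

lemma IsMonotoneOperator.mul_norm_sub_le {F : H → H} (hF : IsMonotoneOperator F) {a : ℝ}
    (ha : 0 ≤ a) (u v : H) : a * ‖u - v‖ ≤ ‖(F u + a • u) - (F v + a • v)‖ := by
  refine le_of_sq_le_sq ?_ (norm_nonneg _)
  nlinarith [hF.norm_add_smul_sub_sq ha u v, sq_nonneg ‖F u - F v‖]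

lemma IsMonotoneOperator.norm_image_sub_le {F : H → H} (hF : IsMonotoneOperator F) {a : ℝ}
    (ha : 0 ≤ a) (u v : H) : ‖F u - F v‖ ≤ ‖(F u + a • u) - (F v + a • v)‖ := by
  refine le_of_sq_le_sq ?_ (norm_nonneg _)
  nlinarith [hF.norm_add_smul_sub_sq ha u v, sq_nonneg (a * ‖u - v‖)]

/-- Surjectivity of `F + a I`. On a large ball, the gradient-type step
`v ↦ v - τ (F v + a v - x)` with a small `τ` is a contraction of the ball into itself. -/
lemma IsMonotoneOperator.exists_add_smul_eq [CompleteSpace H] {F : H → H}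
    (hF : IsMonotoneOperator F) (hL : LipschitzOnBalls F) {a : ℝ} (ha : 0 < a) (x : H) :
    ∃ v, F v + a • v = x := by
  set r : ℝ := 2 * ‖F 0 - x‖ / a with hr
  have hr0 : 0 ≤ r := by positivity
  have hxr : ‖F 0 - x‖ = a * r / 2 := by rw [hr]; field_simp
  obtain ⟨L, hL⟩ := hL r
  set K : ℝ := max L 0 + a with hK
  have hK0 : 0 < K := by have := le_max_right L 0; linarith
  have haK : a ≤ K := by have := le_max_right L 0; linarith
  set s : ℝ := a ^ 2 / K ^ 2 with hs
  have hs0 : 0 < s := by positivity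
  have hs1 : s ≤ 1 := by
    rw [hs, div_le_one (by positivity)]; gcongr
  set S : H → H := fun v => v - (a / K ^ 2) • (F v + a • v - x) with hS
  have hlip : ∀ u v : H, ‖u‖ ≤ r → ‖v‖ ≤ r → ‖S u - S v‖ ≤ (1 - s / 2) * ‖u - v‖ := by
    intro u v hu hv
    set D := (F u + a • u) - (F v + a • v) with hD
    have e : S u - S v = (u - v) - (a / K ^ 2) • D := by
      simp only [hS, hD, smul_sub, smul_add]; abel
    have h1 : ‖D‖ ≤ K * ‖u - v‖ := by
      have e2 : D = (F u - F v) + a • (u - v) := by rw [hD, smul_sub]; abel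
      calc ‖D‖ ≤ ‖F u - F v‖ + ‖a • (u - v)‖ := e2 ▸ norm_add_le _ _
        _ ≤ max L 0 * ‖u - v‖ + a * ‖u - v‖ := by
          rw [norm_smul, Real.norm_eq_abs, abs_of_pos ha]
          gcongr
          exact (hL u v hu hv).trans (by gcongr; exact le_max_left _ _)
        _ = K * ‖u - v‖ := by rw [hK]; ring
    have h2 := hF.le_inner_add_smul a u v
    rw [← hD, real_inner_comm] at h2
    have h3 : ‖D‖ ^ 2 ≤ K ^ 2 * ‖u - v‖ ^ 2 := by
      rw [← mul_pow]; gcongr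
    refine le_of_sq_le_sq ?_ (mul_nonneg (by linarith) (norm_nonneg _))
    rw [e, norm_sub_sq_real, real_inner_smul_right, norm_smul, Real.norm_eq_abs,
      abs_of_pos (by positivity : 0 < a / K ^ 2), mul_pow, mul_pow]
    have h4 : a / K ^ 2 * (a * ‖u - v‖ ^ 2) ≤ a / K ^ 2 * inner ℝ (u - v) D := by gcongr
    have h5 : (a / K ^ 2) ^ 2 * ‖D‖ ^ 2 ≤ (a / K ^ 2) ^ 2 * (K ^ 2 * ‖u - v‖ ^ 2) := by gcongr
    have h6 : (a / K ^ 2) ^ 2 * (K ^ 2 * ‖u - v‖ ^ 2) = s * ‖u - v‖ ^ 2 := by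
      rw [hs]; field_simp
    have h7 : a / K ^ 2 * (a * ‖u - v‖ ^ 2) = s * ‖u - v‖ ^ 2 := by
      rw [hs]; field_simp
    nlinarith [mul_nonneg (sq_nonneg s) (sq_nonneg ‖u - v‖)]
  have hmaps : MapsTo S (Metric.closedBall 0 r) (Metric.closedBall 0 r) := by
    intro v hv
    rw [mem_closedBall_zero_iff] at hv ⊢
    have h0 : ‖S 0‖ = s / 2 * r := by
      simp only [hS, smul_zero, add_zero, zero_sub, norm_neg, norm_smul, Real.norm_eq_abs]
      rw [abs_of_pos (by positivity : 0 < a / K ^ 2), hxr, hs]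
      field_simp
    have h1 := hlip v 0 hv (by simpa using hr0)
    rw [sub_zero] at h1
    calc ‖S v‖ ≤ ‖S v - S 0‖ + ‖S 0‖ := by simpa using norm_add_le (S v - S 0) (S 0)
      _ ≤ (1 - s / 2) * r + s / 2 * r := by
        rw [h0]; gcongr
        exact h1.trans (mul_le_mul_of_nonneg_left hv (by linarith))
      _ = r := by ring
  have hcontr : ContractingWith (Real.toNNReal (1 - s / 2)) (hmaps.restrict S _ _) := by
    refine ⟨by rw [← NNReal.coe_lt_coe, Real.coe_toNNReal _ (by linarith)]; simpa using hs0,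
      LipschitzWith.of_dist_le_mul fun u v => ?_⟩
    rw [Real.coe_toNNReal _ (by linarith), Subtype.dist_eq, Subtype.dist_eq, dist_eq_norm,
      dist_eq_norm]
    exact hlip u v (mem_closedBall_zero_iff.1 u.2) (mem_closedBall_zero_iff.1 v.2)
  obtain ⟨v, -, hv, -⟩ := hcontr.exists_fixedPoint' Metric.isClosed_closedBall.isComplete hmaps
    (x := 0) (by simpa using hr0) (edist_ne_top _ _)
  refine ⟨v, ?_⟩
  have h : (a / K ^ 2) • (F v + a • v - x) = 0 := by
    have : v - (a / K ^ 2) • (F v + a • v - x) = v := hv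
    simpa using this
  rcases smul_eq_zero.1 h with h | h
  · exact absurd h (by positivity)
  · exact sub_eq_zero.1 h

open Classical in
/-- The regularized solution operator `(F + a I)⁻¹`. Where the equation `F v + a v = x` has no
solution, the value is `0`; for monotone `F` and `a > 0` this does not occur. -/
noncomputable def regSol (F : H → H) (a : ℝ) (x : H) : H :=
  if h : ∃ v, F v + a • v = x then h.choose else 0

/-- The hypotheses on `F` under which `F + a I` is a bijection for every `a > 0`. -/
structure IsRegularizable (F : H → H) : Prop where
  mono : IsMonotoneOperator F
  lip : LipschitzOnBalls F

namespace IsRegularizable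

variable [CompleteSpace H] {F : H → H} (hF : IsRegularizable F) {a : ℝ} (ha : 0 < a)

include hF

include ha in
lemma regSol_spec (x : H) : F (regSol F a x) + a • regSol F a x = x := by
  have h := hF.mono.exists_add_smul_eq hF.lip ha x
  rw [regSol, dif_pos h]
  exact h.choose_spec

include ha in
lemma eq_regSol_iff {v x : H} : v = regSol F a x ↔ F v + a • v = x := by
  refine ⟨fun h => h ▸ hF.regSol_spec ha x, fun h => ?_⟩
  have h1 := hF.mono.mul_norm_sub_le ha.le v (regSol F a x)
  rw [h, hF.regSol_spec ha, sub_self, norm_zero] at h1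
  have h2 : ‖v - regSol F a x‖ ≤ 0 := nonpos_of_mul_nonpos_right h1 ha
  exact sub_eq_zero.1 (norm_le_zero_iff.1 h2)

include ha in
lemma mul_norm_regSol_sub_le (x x' : H) : a * ‖regSol F a x - regSol F a x'‖ ≤ ‖x - x'‖ := by
  simpa only [hF.regSol_spec ha] using
    hF.mono.mul_norm_sub_le ha.le (regSol F a x) (regSol F a x')

/-- A solution for the parameter `a` solves the equation for another parameter with a perturbed
right-hand side. -/
lemma regSol_eq_regSol_add {a a' : ℝ} (ha : 0 < a) (ha' : 0 < a') (x : H) :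
    regSol F a x = regSol F a' (x + (a' - a) • regSol F a x) := by
  rw [hF.eq_regSol_iff ha', sub_smul]
  linear_combination (norm := module) hF.regSol_spec ha x

lemma continuousOn_regSol :
    ContinuousOn (fun p : ℝ × H => regSol F p.1 p.2) (Ioi 0 ×ˢ univ) := by
  rintro ⟨a, x⟩ ⟨ha, -⟩
  have ha : 0 < a := ha
  rw [ContinuousWithinAt, tendsto_iff_norm_sub_tendsto_zero]
  have hlim : Tendsto (fun p : ℝ × H => ‖p.2 - (x + (p.1 - a) • regSol F a x)‖ / p.1)
      (𝓝[Ioi 0 ×ˢ univ] (a, x)) (𝓝 0) := by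
    have : ContinuousAt (fun p : ℝ × H => ‖p.2 - (x + (p.1 - a) • regSol F a x)‖ / p.1) (a, x) :=
      ContinuousAt.div (by fun_prop) (by fun_prop) ha.ne'
    simpa [ContinuousAt] using this.tendsto.mono_left nhdsWithin_le_nhds
  refine squeeze_zero' (Eventually.of_forall fun _ => norm_nonneg _) ?_ hlim
  filter_upwards [self_mem_nhdsWithin] with p hp
  have hp : 0 < p.1 := hp.1
  rw [le_div_iff₀' hp]
  have h := hF.mul_norm_regSol_sub_le hp p.2 (x + (p.1 - a) • regSol F a x)
  rwa [← hF.regSol_eq_regSol_add ha hp x] at h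

end IsRegularizable

/-- The derivative of a monotone operator is a monotone linear operator. -/
lemma IsMonotoneOperator.inner_fderiv_nonneg {F : H → H} (hF : IsMonotoneOperator F)
    (hd : Differentiable ℝ F) (x h : H) : 0 ≤ inner ℝ (fderiv ℝ F x h) h := by
  have h1 : HasDerivAt (fun t : ℝ => F (x + t • h)) (fderiv ℝ F x h) 0 := by
    have h2 : HasDerivAt (fun t : ℝ => x + t • h) h 0 := by
      simpa using ((hasDerivAt_id (0 : ℝ)).smul_const h).const_add x
    have h3 : HasFDerivAt F (fderiv ℝ F x) (x + (0 : ℝ) • h) := by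
      simpa using (hd x).hasFDerivAt
    exact h3.comp_hasDerivAt 0 h2
  have h4 := ((hasDerivAt_iff_tendsto_slope.1 h1).inner (𝕜 := ℝ)
    (tendsto_const_nhds (x := h)))
  refine ge_of_tendsto h4 ?_
  filter_upwards [self_mem_nhdsWithin] with t ht
  have ht : t ≠ 0 := ht
  have h5 := hF (x + t • h) x
  have e : inner ℝ (slope (fun t : ℝ => F (x + t • h)) 0 t) h
      = (t⁻¹) ^ 2 * inner ℝ (F (x + t • h) - F x) (x + t • h - x) := by
    rw [slope_def_module, add_sub_cancel_left, real_inner_smul_left, real_inner_smul_right]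
    simp only [zero_smul, add_zero, sub_zero]
    field_simp
  rw [e]
  positivity

lemma IsMonotoneOperator.exists_equiv_fderiv [CompleteSpace H] {F : H → H} (hF : IsMonotoneOperator F)
    (hd : Differentiable ℝ F) {a : ℝ} (ha : 0 < a) (x : H) :
    ∃ e : H ≃L[ℝ] H, (e : H →L[ℝ] H) = fderiv ℝ F x + a • ContinuousLinearMap.id ℝ H := by
  have hA : IsRegularizable (fderiv ℝ F x : H → H) := by
    refine ⟨fun u v => ?_, fun r => ⟨‖fderiv ℝ F x‖, fun u v _ _ => ?_⟩⟩
    · rw [← map_sub]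
      exact hF.inner_fderiv_nonneg hd x _
    · rw [← map_sub]
      exact ContinuousLinearMap.le_opNorm _ _
  refine ⟨ContinuousLinearEquiv.ofBijective
    (fderiv ℝ F x + a • ContinuousLinearMap.id ℝ H) ?_ ?_,
    ContinuousLinearEquiv.coe_ofBijective _ _ _⟩
  · refine LinearMap.ker_eq_bot'.2 fun u hu => ?_
    rw [(hA.eq_regSol_iff ha (v := u) (x := 0)).2 (by simpa using hu)]
    exact ((hA.eq_regSol_iff ha (v := 0) (x := 0)).2 (by simp)).symm
  · refine LinearMap.range_eq_top.2 fun w => ⟨regSol (fderiv ℝ F x) a w, ?_⟩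
    simpa using hA.regSol_spec ha w

end Resolvent

/-! ### Damped equations with a small Lipschitz perturbation -/

section DampedEquation

variable {E : Type*} [NormedAddCommGroup E] [NormedSpace ℝ E]

lemma hasDerivAt_exp_neg_smul_integral [CompleteSpace E] {g : ℝ → E} (hg : Continuous g) (w₀ : E)
    (t : ℝ) :
    HasDerivAt (fun t => Real.exp (-t) • (w₀ + ∫ s in (0 : ℝ)..t, Real.exp s • g s))
      (-(Real.exp (-t) • (w₀ + ∫ s in (0 : ℝ)..t, Real.exp s • g s)) + g t) t := by
  have hc : Continuous fun s => Real.exp s • g s := by fun_prop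
  have h1 : HasDerivAt (fun t => w₀ + ∫ s in (0 : ℝ)..t, Real.exp s • g s) (Real.exp t • g t) t :=
    (intervalIntegral.integral_hasDerivAt_right (hc.intervalIntegrable _ _)
      (hc.stronglyMeasurableAtFilter _ _) hc.continuousAt).const_add _
  have h2 : HasDerivAt (fun t : ℝ => Real.exp (-t)) (-Real.exp (-t)) t := by
    simpa using (hasDerivAt_neg t).exp
  refine (h2.smul h1).congr_deriv ?_
  rw [smul_smul, ← Real.exp_add, neg_add_cancel, Real.exp_zero, one_smul, neg_smul, add_comm]

/-- Duhamel's integral operator of the equation `w' = -w + G t w` is a contraction for the supremum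
norm on an interval of arbitrary length as soon as `G t` is Lipschitz with a constant `q < 1`,
because `exp (-t) * ∫ s in 0..t, exp s ≤ 1`. So solutions are global. -/
lemma exists_hasDerivWithinAt_neg_add [CompleteSpace E] {T : ℝ} (hT : 0 ≤ T) {G : ℝ → E → E}
    {q : ℝ} (hq0 : 0 ≤ q) (hq1 : q < 1)
    (hc : ContinuousOn (fun p : ℝ × E => G p.1 p.2) (Icc 0 T ×ˢ univ))
    (hl : ∀ t ∈ Icc 0 T, ∀ x y, ‖G t x - G t y‖ ≤ q * ‖x - y‖) (w₀ : E) :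
    ∃ w : ℝ → E, w 0 = w₀ ∧
      ∀ t ∈ Icc 0 T, HasDerivWithinAt w (-w t + G t (w t)) (Icc 0 T) t := by
  set I : C(Icc 0 T, E) → ℝ → E := fun w => IccExtend hT fun s => G s (w s) with hI
  have hIc : ∀ w, Continuous (I w) := fun w => by
    refine Continuous.Icc_extend' ?_
    exact hc.comp_continuous (f := fun s : Icc 0 T => ((s : ℝ), w s)) (by fun_prop)
      fun s => ⟨s.2, mem_univ _⟩
  set W : C(Icc 0 T, E) → ℝ → E :=
    fun w t => Real.exp (-t) • (w₀ + ∫ s in (0 : ℝ)..t, Real.exp s • I w s) with hW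
  have hWd : ∀ w t, HasDerivAt (W w) (-W w t + I w t) t := fun w t =>
    hasDerivAt_exp_neg_smul_integral (hIc w) w₀ t
  have hWc : ∀ w, Continuous (W w) := fun w =>
    continuous_iff_continuousAt.2 fun t => (hWd w t).continuousAt
  set P : C(Icc 0 T, E) → C(Icc 0 T, E) := fun w =>
    ⟨fun t => W w t, (hWc w).comp continuous_subtype_val⟩ with hP
  have hcontr : ContractingWith (Real.toNNReal q) P := by
    refine ⟨by rw [← NNReal.coe_lt_coe, Real.coe_toNNReal _ hq0]; simpa using hq1,
      LipschitzWith.of_dist_le_mul fun w v => ?_⟩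
    rw [Real.coe_toNNReal _ hq0, ContinuousMap.dist_le (by positivity)]
    rintro ⟨t, ht⟩
    have e : P w ⟨t, ht⟩ - P v ⟨t, ht⟩
        = Real.exp (-t) • ∫ s in (0 : ℝ)..t, Real.exp s • (I w s - I v s) := by
      have hi : ∀ w, IntervalIntegrable (fun s => Real.exp s • I w s) MeasureTheory.volume 0 t :=
        fun w => (Real.continuous_exp.smul (hIc w)).intervalIntegrable _ _
      simp only [hP, hW, ContinuousMap.coe_mk, smul_sub]
      rw [intervalIntegral.integral_sub (hi w) (hi v), smul_sub, smul_add, smul_add]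
      abel
    have hbd : ‖∫ s in (0 : ℝ)..t, Real.exp s • (I w s - I v s)‖
        ≤ ∫ s in (0 : ℝ)..t, Real.exp s * (q * dist w v) := by
      refine intervalIntegral.norm_integral_le_of_norm_le ht.1
        (Eventually.of_forall fun s hs => ?_) (Continuous.intervalIntegrable (by fun_prop) _ _)
      have hsT : s ∈ Icc 0 T := ⟨hs.1.le, hs.2.trans ht.2⟩
      rw [norm_smul, Real.norm_eq_abs, abs_of_pos (Real.exp_pos s)]
      simp only [hI, IccExtend_of_mem _ _ hsT]
      gcongr
      refine (hl s hsT _ _).trans ?_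
      gcongr
      rw [← dist_eq_norm]
      exact ContinuousMap.dist_apply_le_dist _
    rw [intervalIntegral.integral_mul_const, integral_exp, Real.exp_zero] at hbd
    rw [dist_eq_norm, e, norm_smul, Real.norm_eq_abs, abs_of_pos (Real.exp_pos _)]
    calc Real.exp (-t) * _ ≤ Real.exp (-t) * ((Real.exp t - 1) * (q * dist w v)) := by gcongr
      _ = (1 - Real.exp (-t)) * (q * dist w v) := by
        rw [← mul_assoc, mul_sub, ← Real.exp_add, neg_add_cancel, Real.exp_zero, mul_one]
      _ ≤ 1 * (q * dist w v) := by
        gcongr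
        linarith [Real.exp_pos (-t)]
      _ = q * dist w v := one_mul _
  set w := ContractingWith.fixedPoint P hcontr
  have hw : P w = w := hcontr.fixedPoint_isFixedPt
  refine ⟨W w, by simp [hW], fun t ht => ?_⟩
  have h : I w t = G t (W w t) := by
    simp only [hI, IccExtend_of_mem _ _ ht]
    congr 1
    exact (DFunLike.congr_fun hw ⟨t, ht⟩).symm
  rw [← h]
  exact (hWd w t).hasDerivWithinAt

end DampedEquation

/-! ### The gain function -/

section Gain

variable {b c d : ℝ}

lemma gain_pos (hc : 0 < c) (hd : 0 < d) {t : ℝ} (ht : 0 ≤ t) : 0 < gain b c d t := by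
  have : 0 < c + t := by linarith
  rw [gain]; positivity

lemma hasDerivAt_gain (hc : 0 < c) {t : ℝ} (ht : 0 ≤ t) :
    HasDerivAt (gain b c d) (-(b / (c + t) * gain b c d t)) t := by
  have h : 0 < c + t := by linarith
  have h1 : HasDerivAt (fun t => (c + t) ^ b) (1 * b * (c + t) ^ (b - 1)) t :=
    ((hasDerivAt_id t).const_add c).rpow_const (Or.inl h.ne')
  refine ((hasDerivAt_const t d).div h1 (by positivity)).congr_deriv ?_
  rw [gain, Real.rpow_sub_one h.ne']
  field_simp
  ring

lemma tendsto_gain_atTop (hb : 0 < b) : Tendsto (gain b c d) atTop (𝓝 0) :=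
  ((tendsto_rpow_atTop hb).comp (tendsto_atTop_add_const_left _ c tendsto_id)).const_div_atTop d

lemma gain_anti (hb : 0 ≤ b) (hc : 0 < c) (hd : 0 < d) {s t : ℝ} (hs : 0 ≤ s) (hst : s ≤ t) :
    gain b c d t ≤ gain b c d s := by
  have : 0 < c + s := by linarith
  rw [gain, gain]; gcongr

lemma continuousOn_gain (hc : 0 < c) : ContinuousOn (gain b c d) (Ici 0) :=
  fun _ ht => (hasDerivAt_gain hc ht).continuousAt.continuousWithinAt

end Gain

/-! ### Existence for the Newton-type flow -/

section Flow

/-- Differentiating a scalar function vanishing at `t` times a merely continuous one. -/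
lemma HasDerivAt.sub_smul_of_continuousWithinAt {E : Type*} [NormedAddCommGroup E]
    [NormedSpace ℝ E] {a : ℝ → ℝ} {a' t : ℝ} {u : ℝ → E} {s : Set ℝ} (ha : HasDerivAt a a' t)
    (hu : ContinuousWithinAt u s t) :
    HasDerivWithinAt (fun r => (a t - a r) • u r) (-(a' • u t)) s t := by
  rw [hasDerivWithinAt_iff_tendsto_slope]
  have h1 : Tendsto (slope a t) (𝓝[s \ {t}] t) (𝓝 a') :=
    hasDerivWithinAt_iff_tendsto_slope.1 ha.hasDerivWithinAt
  have h2 : Tendsto u (𝓝[s \ {t}] t) (𝓝 (u t)) := hu.mono_left (nhdsWithin_mono _ sdiff_subset)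
  refine (h1.smul h2).neg.congr fun r => ?_
  simp only [slope_def_module, sub_self, zero_smul, sub_zero, smul_eq_mul]
  module

variable {H : Type*} [NormedAddCommGroup H] [InnerProductSpace ℝ H] [CompleteSpace H]
  {F : H → H} (hF : IsRegularizable F) (hd : Differentiable ℝ F)

include hF hd

lemma IsRegularizable.hasFDerivAt_regSol {a : ℝ} (ha : 0 < a) (x : H) {e : H ≃L[ℝ] H}
    (he : (e : H →L[ℝ] H) =
      fderiv ℝ F (regSol F a x) + a • ContinuousLinearMap.id ℝ H) :
    HasFDerivAt (regSol F a) (e.symm : H →L[ℝ] H) x := by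
  refine HasFDerivAt.of_local_left_inverse (f := fun v => F v + a • v) ?_ ?_
    (Eventually.of_forall fun y => hF.regSol_spec ha y)
  · exact ((hF.continuousOn_regSol (a, x) ⟨ha, mem_univ _⟩).comp (f := fun y => (a, y))
      (s := univ) (by fun_prop) fun _ _ => ⟨ha, mem_univ _⟩).continuousAt univ_mem
  · rw [he]
    exact (hd _).hasFDerivAt.add ((hasFDerivAt_id _).const_smul a)

/-- The chain rule for `(F + a I)⁻¹` along a curve of parameters and right-hand sides. Only the
right-hand side need vary: the change of the parameter is moved there. -/
lemma IsRegularizable.hasDerivWithinAt_regSol {a : ℝ → ℝ} {a' t : ℝ} {x : ℝ → H} {x' : H}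
    {s : Set ℝ} (ht : t ∈ s) (hpos : ∀ r ∈ s, 0 < a r) (ha : HasDerivAt a a' t)
    (hx : HasDerivWithinAt x x' s t)
    (hu : ContinuousWithinAt (fun r => regSol F (a r) (x r)) s t) {e : H ≃L[ℝ] H}
    (he : (e : H →L[ℝ] H) =
      fderiv ℝ F (regSol F (a t) (x t)) + a t • ContinuousLinearMap.id ℝ H) :
    HasDerivWithinAt (fun r => regSol F (a r) (x r))
      (e.symm (x' - a' • regSol F (a t) (x t))) s t := by
  have h := hx.add (ha.sub_smul_of_continuousWithinAt hu)
  rw [← sub_eq_add_neg] at h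
  have h2 : HasFDerivAt (regSol F (a t)) (e.symm : H →L[ℝ] H)
      (x t + (a t - a t) • regSol F (a t) (x t)) := by
    refine hF.hasFDerivAt_regSol hd (hpos t ht) _ ?_
    rw [he, sub_self, zero_smul, add_zero]
  exact (h2.comp_hasDerivWithinAt t h).congr
    (fun r hr => hF.regSol_eq_regSol_add (hpos r hr) (hpos t ht) _)
    (hF.regSol_eq_regSol_add (hpos t ht) (hpos t ht) _)

variable {b c d : ℝ}

/-- The Newton-type Cauchy problem is equivalent to an equation for the residual
`w = F u + a u - g`, namely `w' = -w + a' u` with `u = (F + a I)⁻¹ (g + w)`. Here `a' u` is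
globally Lipschitz in `w` with the constant `|a'| / a = b / (c + t) < 1`. -/
lemma IsRegularizable.exists_isDSMSolution (hb : 0 < b) (hc : 0 < c) (hbc : b < c) (hd0 : 0 < d)
    (g u₀ : H) {T : ℝ} (hT : 0 ≤ T) :
    ∃ u : ℝ → H, IsDSMSolution F (gain b c d) g u₀ T u := by
  set a := gain b c d with ha
  have hapos : ∀ {t}, t ∈ Icc 0 T → 0 < a t := fun ht => gain_pos hc hd0 ht.1
  set G : ℝ → H → H := fun t w => -(b / (c + t) * a t) • regSol F (a t) (g + w) with hG
  have hac : ContinuousOn a (Icc 0 T) := (continuousOn_gain hc).mono Icc_subset_Ici_self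
  have hcp : ∀ {t}, t ∈ Icc 0 T → c + t ≠ 0 := fun ht => by linarith [ht.1]
  have hR : ContinuousOn (fun p : ℝ × H => regSol F (a p.1) (g + p.2)) (Icc 0 T ×ˢ univ) := by
    refine hF.continuousOn_regSol.comp (f := fun p : ℝ × H => (a p.1, g + p.2)) ?_
      fun p hp => ⟨hapos hp.1, mem_univ _⟩
    exact (hac.comp continuousOn_fst fun p hp => hp.1).prodMk (by fun_prop)
  have hGc : ContinuousOn (fun p : ℝ × H => G p.1 p.2) (Icc 0 T ×ˢ univ) := by
    refine ContinuousOn.smul (ContinuousOn.neg (ContinuousOn.mul ?_ ?_)) hR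
    · exact ContinuousOn.div (by fun_prop) (by fun_prop) fun p hp => hcp hp.1
    · exact hac.comp continuousOn_fst fun p hp => hp.1
  obtain ⟨w, hw0, hw⟩ := exists_hasDerivWithinAt_neg_add hT (G := G) (q := b / c) (by positivity)
    ((div_lt_one hc).2 hbc) hGc (fun t ht x y => by
      have hct : 0 < c + t := by linarith [ht.1]
      have h := hF.mul_norm_regSol_sub_le (hapos ht) (g + x) (g + y)
      rw [add_sub_add_left_eq_sub] at h
      simp only [hG]
      rw [← smul_sub, norm_smul, norm_neg, Real.norm_eq_abs,
        abs_of_pos (mul_pos (div_pos hb hct) (hapos ht)), mul_assoc]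
      gcongr
      · exact mul_nonneg (hapos ht).le (norm_nonneg _)
      · linarith [ht.1]) (F u₀ + a 0 • u₀ - g)
  set u : ℝ → H := fun t => regSol F (a t) (g + w t) with hu
  have hwc : ContinuousOn w (Icc 0 T) := fun t ht => (hw t ht).continuousWithinAt
  have huc : ContinuousOn u (Icc 0 T) :=
    hR.comp (f := fun t => (t, w t)) (continuousOn_id.prodMk hwc) fun t ht => ⟨ht, mem_univ _⟩
  refine ⟨u, ?_, fun t ht => ?_⟩
  · refine ((hF.eq_regSol_iff (hapos ⟨le_rfl, hT⟩)).2 ?_).symm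
    rw [hw0]; abel
  obtain ⟨e, he⟩ := hF.mono.exists_equiv_fderiv hd (hapos ht) (u t)
  rw [← he, ContinuousLinearMap.inverse_equiv]
  refine ⟨⟨e, rfl⟩, ?_⟩
  have hspec : F (u t) + a t • u t - g = w t := by
    rw [hu, hF.regSol_spec (hapos ht)]; abel
  have h := hF.hasDerivWithinAt_regSol hd ht (fun r hr => hapos hr) (hasDerivAt_gain hc ht.1)
    ((hw t ht).const_add g) (huc t ht) he
  refine h.congr_deriv ?_
  rw [hspec]
  simp only [hG, ha, ContinuousLinearEquiv.coe_coe, ← map_neg]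
  congr 1
  abel

omit hF [CompleteSpace H] in
/-- The residual along a solution decays up to the drift `a' u`. -/
lemma IsDSMSolution.hasDerivWithinAt_residual (hc : 0 < c) {g u₀ : H} {T : ℝ} {u : ℝ → H}
    (hu : IsDSMSolution F (gain b c d) g u₀ T u) {t : ℝ} (ht : t ∈ Icc 0 T) :
    HasDerivWithinAt (fun t => F (u t) + gain b c d t • u t - g)
      (-(F (u t) + gain b c d t • u t - g) - (b / (c + t) * gain b c d t) • u t)
      (Icc 0 T) t := by
  obtain ⟨⟨e, he⟩, hdu⟩ := hu.2 t ht
  rw [← he, ContinuousLinearMap.inverse_equiv] at hdu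
  have h := (((hd (u t)).hasFDerivAt.comp_hasDerivWithinAt t hdu).add
    ((hasDerivAt_gain (b := b) (d := d) hc ht.1).hasDerivWithinAt.smul hdu)).sub_const g
  refine h.congr_deriv ?_
  have h2 := DFunLike.congr_fun he (e.symm (F (u t) + gain b c d t • u t - g))
  simp only [ContinuousLinearEquiv.coe_coe, ContinuousLinearEquiv.apply_symm_apply,
    _root_.add_apply, _root_.smul_apply, ContinuousLinearMap.id_apply]
    at h2
  simp only [ContinuousLinearEquiv.coe_coe, map_neg]
  linear_combination (norm := module) h2

end Flow

/-! ### Regularization with exact data -/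

section ExactData

variable {H : Type*} [NormedAddCommGroup H] [InnerProductSpace ℝ H] {F : H → H}

/-- Solutions of the regularized equation grow in norm as the parameter decreases, and the growth
of the squared norm controls their distance. The case `a = 0` concerns solutions of `F u = x`. -/
lemma IsMonotoneOperator.norm_sub_sq_le (hF : IsMonotoneOperator F) {a a' : ℝ} (ha : 0 ≤ a)
    (haa : a < a') {u v x : H} (hu : F u + a • u = x) (hv : F v + a' • v = x) :
    ‖u - v‖ ^ 2 ≤ ‖u‖ ^ 2 - ‖v‖ ^ 2 := by
  have h := hF u v
  have e : F u - F v = (a' - a) • v - a • (u - v) := by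
    rw [eq_sub_of_add_eq hu, eq_sub_of_add_eq hv]; module
  rw [e, inner_sub_left, real_inner_smul_left, real_inner_smul_left,
    real_inner_self_eq_norm_sq] at h
  have h1 : 0 ≤ inner ℝ v (u - v) := by
    have h2 : 0 ≤ (a' - a) * inner ℝ v (u - v) := by nlinarith [mul_nonneg ha (sq_nonneg ‖u - v‖)]
    exact nonneg_of_mul_nonneg_right h2 (sub_pos.2 haa)
  have h3 : ‖u‖ ^ 2 = ‖v‖ ^ 2 + 2 * inner ℝ v (u - v) + ‖u - v‖ ^ 2 := by
    rw [← norm_add_sq_real, add_sub_cancel]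
  linarith

lemma IsMonotoneOperator.norm_le_of_add_smul_eq (hF : IsMonotoneOperator F) {a a' : ℝ}
    (ha : 0 ≤ a) (haa : a < a') {u v x : H} (hu : F u + a • u = x) (hv : F v + a' • v = x) :
    ‖v‖ ≤ ‖u‖ := by
  refine le_of_sq_le_sq ?_ (norm_nonneg _)
  linarith [hF.norm_sub_sq_le ha haa hu hv, sq_nonneg ‖u - v‖]

variable [CompleteSpace H] (hF : IsRegularizable F)

include hF

lemma IsRegularizable.norm_regSol_anti {a a' : ℝ} (ha : 0 < a) (haa : a ≤ a') (x : H) :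
    ‖regSol F a' x‖ ≤ ‖regSol F a x‖ := by
  rcases haa.eq_or_lt with rfl | h
  · rfl
  · exact hF.mono.norm_le_of_add_smul_eq ha.le h (hF.regSol_spec ha x)
      (hF.regSol_spec (ha.trans h) x)

lemma IsRegularizable.norm_regSol_le {a : ℝ} (ha : 0 < a) {x y : H} (hy : F y = x) :
    ‖regSol F a x‖ ≤ ‖y‖ :=
  hF.mono.norm_le_of_add_smul_eq le_rfl ha (by simpa using hy) (hF.regSol_spec ha x)

lemma IsRegularizable.cauchy_regSol {x y : H} (hy : F y = x) :
    Cauchy (map (fun a => regSol F a x) (𝓝[>] 0)) := by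
  set N : ℝ → ℝ := fun a => ‖regSol F a x‖ ^ 2 with hN
  have hbdd : BddAbove (N '' Ioi 0) := by
    refine ⟨‖y‖ ^ 2, ?_⟩
    rintro _ ⟨a, ha, rfl⟩
    have := hF.norm_regSol_le ha hy
    simp only [hN]; gcongr
  refine Metric.cauchy_iff.2 ⟨inferInstance, fun ε hε => ?_⟩
  obtain ⟨_, ⟨a₀, ha₀, rfl⟩, hlt⟩ := exists_lt_of_lt_csSup (s := N '' Ioi 0) ⟨N 1, 1, mem_Ioi.2 one_pos, rfl⟩
    (sub_lt_self (sSup (N '' Ioi 0)) (by positivity : 0 < (ε / 2) ^ 2))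
  have hclose : ∀ a ∈ Ioo 0 a₀, dist (regSol F a x) (regSol F a₀ x) < ε / 2 := by
    intro a ha
    rw [dist_eq_norm]
    refine lt_of_pow_lt_pow_left₀ 2 (by positivity) ?_
    have h1 := hF.mono.norm_sub_sq_le ha.1.le ha.2 (hF.regSol_spec ha.1 x) (hF.regSol_spec ha₀ x)
    have h2 : N a ≤ sSup (N '' Ioi 0) := le_csSup hbdd ⟨a, ha.1, rfl⟩
    simp only [hN] at h2 hlt
    linarith
  refine ⟨(fun a => regSol F a x) '' Ioo 0 a₀, image_mem_map (Ioo_mem_nhdsGT ha₀), ?_⟩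
  rintro _ ⟨a, ha, rfl⟩ _ ⟨a', ha', rfl⟩
  linarith [dist_triangle_right (regSol F a x) (regSol F a' x) (regSol F a₀ x),
    hclose a ha, hclose a' ha']

/-- Convergence of Tikhonov-type regularization with exact data. The limit solves `F u = f`, and
`‖y - V‖² ≤ ‖y‖² - ‖V‖²` passes to the limit, which identifies it with the solution `y` of minimal
norm. -/
lemma IsRegularizable.tendsto_regSol (hc : Continuous F) {f y : H}
    (hy : IsMinimalNormSolution F f y) : Tendsto (fun a => regSol F a f) (𝓝[>] 0) (𝓝 y) := by
  obtain ⟨z, hz⟩ := CompleteSpace.complete (hF.cauchy_regSol hy.1)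
  have hz : Tendsto (fun a => regSol F a f) (𝓝[>] 0) (𝓝 z) := hz
  have hid : Tendsto (fun a : ℝ => a) (𝓝[>] 0) (𝓝 0) := nhdsWithin_le_nhds
  have hFz : F z = f := by
    have h1 := ((hc.tendsto z).comp hz).add (hid.smul hz)
    rw [zero_smul, add_zero] at h1
    refine tendsto_nhds_unique h1 (tendsto_const_nhds.congr' ?_)
    filter_upwards [self_mem_nhdsWithin] with a ha
    exact (hF.regSol_spec ha f).symm
  have h2 : ‖y - z‖ ^ 2 ≤ ‖y‖ ^ 2 - ‖z‖ ^ 2 := by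
    refine le_of_tendsto_of_tendsto ((tendsto_const_nhds.sub hz).norm.pow 2)
      (tendsto_const_nhds.sub (hz.norm.pow 2)) ?_
    filter_upwards [self_mem_nhdsWithin] with a ha
    exact hF.mono.norm_sub_sq_le le_rfl ha (by simpa using hy.1) (hF.regSol_spec ha f)
  have h3 : ‖y‖ ^ 2 ≤ ‖z‖ ^ 2 := by gcongr; exact hy.2 z hFz
  have h4 : ‖y - z‖ ^ 2 = 0 := le_antisymm (by linarith) (sq_nonneg _)
  rw [sub_eq_zero.1 (norm_eq_zero.1 (pow_eq_zero_iff two_ne_zero |>.1 h4))]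
  exact hz

end ExactData

/-! ### Uniqueness and decay of the residual -/

section Residual

variable {H : Type*} [NormedAddCommGroup H] [InnerProductSpace ℝ H] {F : H → H} {b c d : ℝ}
  {g u₀ : H} {T : ℝ} {u : ℝ → H}

lemma IsDSMSolution.mono {a : ℝ → ℝ} (hu : IsDSMSolution F a g u₀ T u) {S : ℝ} (hS : S ≤ T) :
    IsDSMSolution F a g u₀ S u :=
  ⟨hu.1, fun t ht => ⟨(hu.2 t ⟨ht.1, ht.2.trans hS⟩).1,
    (hu.2 t ⟨ht.1, ht.2.trans hS⟩).2.mono (Icc_subset_Icc_right hS)⟩⟩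

lemma IsDSMSolution.continuousOn {a : ℝ → ℝ} (hu : IsDSMSolution F a g u₀ T u) :
    ContinuousOn u (Icc 0 T) :=
  fun t ht => (hu.2 t ht).2.continuousWithinAt

lemma IsDSMSolution.hasDerivWithinAt_exp_smul_residual (hd : Differentiable ℝ F) (hc : 0 < c)
    (hu : IsDSMSolution F (gain b c d) g u₀ T u) {t : ℝ} (ht : t ∈ Icc 0 T) :
    HasDerivWithinAt (fun t => Real.exp t • (F (u t) + gain b c d t • u t - g))
      (-((Real.exp t * (b / (c + t) * gain b c d t)) • u t)) (Icc 0 T) t := by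
  refine ((Real.hasDerivAt_exp t).hasDerivWithinAt.smul
    (hu.hasDerivWithinAt_residual hd hc ht)).congr_deriv ?_
  module

/-- The residuals of two solutions satisfy a linear differential inequality. -/
lemma IsDSMSolution.eqOn (hF : IsMonotoneOperator F) (hd : Differentiable ℝ F) (hb : 0 < b)
    (hc : 0 < c) (hd0 : 0 < d) {v : ℝ → H} (hu : IsDSMSolution F (gain b c d) g u₀ T u)
    (hv : IsDSMSolution F (gain b c d) g u₀ T v) : EqOn u v (Icc 0 T) := by
  intro t ht
  have hderiv : ∀ s ∈ Icc 0 T, HasDerivWithinAt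
      (fun s => Real.exp s • (F (u s) + gain b c d s • u s - g)
        - Real.exp s • (F (v s) + gain b c d s • v s - g))
      (-((Real.exp s * (b / (c + s) * gain b c d s)) • u s)
        - -((Real.exp s * (b / (c + s) * gain b c d s)) • v s)) (Icc 0 T) s := fun s hs =>
    (hu.hasDerivWithinAt_exp_smul_residual hd hc hs).sub
      (hv.hasDerivWithinAt_exp_smul_residual hd hc hs)
  have hle : ∀ s ∈ Icc 0 T, gain b c d s * ‖u s - v s‖
      ≤ ‖(F (u s) + gain b c d s • u s) - (F (v s) + gain b c d s • v s)‖ := fun s hs =>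
    hF.mul_norm_sub_le (gain_pos hc hd0 hs.1).le _ _
  have h := norm_le_gronwallBound_of_norm_deriv_right_le (δ := 0) (K := b / c) (ε := 0)
    (fun s hs => (hderiv s hs).continuousWithinAt)
    (fun s hs => (hderiv s ⟨hs.1, hs.2.le⟩).mono_of_mem_nhdsWithin
      (Icc_mem_nhdsGE_of_mem hs)) (by simp [hu.1, hv.1]) (fun s hs => by
        have hct : 0 < c + s := by linarith [hs.1]
        have ha := gain_pos (b := b) hc hd0 hs.1
        have h1 := hle s ⟨hs.1, hs.2.le⟩
        have e1 : -((Real.exp s * (b / (c + s) * gain b c d s)) • u s)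
            - -((Real.exp s * (b / (c + s) * gain b c d s)) • v s)
            = -((Real.exp s * (b / (c + s) * gain b c d s)) • (u s - v s)) := by module
        rw [e1, ← smul_sub, sub_sub_sub_cancel_right, norm_neg, norm_smul, norm_smul,
          Real.norm_eq_abs, Real.norm_eq_abs, abs_of_pos (Real.exp_pos s),
          abs_of_pos (by positivity), add_zero]
        calc _ = b / (c + s) * (Real.exp s * (gain b c d s * ‖u s - v s‖)) := by ring
          _ ≤ _ := by
            gcongr
            linarith [hs.1]) t ht
  rw [gronwallBound_ε0_δ0, norm_le_zero_iff, ← smul_sub, sub_sub_sub_cancel_right,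
    smul_eq_zero] at h
  have h1 := hle t ht
  rw [h.resolve_left (Real.exp_ne_zero _), norm_zero] at h1
  exact sub_eq_zero.1 (norm_le_zero_iff.1
    (nonpos_of_mul_nonpos_right h1 (gain_pos hc hd0 ht.1)))

lemma gain_normalized_le_one {p t : ℝ} (hp : 0 ≤ p) (hc : 0 < c) (ht : 0 ≤ t) :
    gain p c (c ^ p) t ≤ 1 := by
  rw [gain, div_le_one (by have : 0 < c + t := by linarith
                           positivity)]
  gcongr; linarith

lemma le_gain_normalized_mul {p t : ℝ} (hp : p ≤ 1) (hc : 0 < c) (ht : 0 ≤ t) :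
    c ≤ gain p c (c ^ p) t * (c + t) := by
  have h : 0 < c + t := by linarith
  have h1 : c / (c + t) ≤ 1 := (div_le_one h).2 (by linarith)
  have h2 := Real.rpow_le_rpow_of_exponent_ge (by positivity) h1 hp
  rw [Real.rpow_one, Real.div_rpow hc.le h.le, div_le_iff₀ h] at h2
  exact h2

/-- The residual stays below a decaying multiple of `a(t) ‖V(t)‖`, where `V` is the regularized
solution. For a fixed final time, with `v` the norm of `V` there, the curve
`exp t * ((c / (c + t)) ^ p * a t) * v / 4` is a strict barrier for `exp t` times the residual.
This is what `6 * b + p < c` is for. -/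
lemma IsDSMSolution.norm_residual_le [CompleteSpace H] (hF : IsRegularizable F)
    (hd : Differentiable ℝ F) (hb : 0 < b) {p : ℝ} (hp0 : 0 ≤ p) (hp1 : p ≤ 1)
    (hc : 6 * b + p < c) (hd0 : 0 < d) (hu : IsDSMSolution F (gain b c d) g u₀ T u)
    (hV : regSol F (gain b c d 0) g ≠ 0)
    (h0 : ‖F u₀ + gain b c d 0 • u₀ - g‖
      ≤ 1 / 4 * gain b c d 0 * ‖regSol F (gain b c d 0) g‖) {t : ℝ} (ht : t ∈ Icc 0 T) :
    ‖F (u t) + gain b c d t • u t - g‖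
      ≤ 1 / 4 * gain p c (c ^ p) t * (gain b c d t * ‖regSol F (gain b c d t) g‖) := by
  have hc0 : 0 < c := by linarith
  set v := ‖regSol F (gain b c d t) g‖ with hv
  have hVv : ∀ s ∈ Icc 0 t, ‖regSol F (gain b c d s) g‖ ≤ v := fun s hs =>
    hF.norm_regSol_anti (gain_pos hc0 hd0 ht.1) (gain_anti hb.le hc0 hd0 hs.1 hs.2) g
  have hv0 : 0 < v := (norm_pos_iff.2 hV).trans_le (hVv 0 ⟨le_rfl, ht.1⟩)
  have hderiv := fun s (hs : s ∈ Icc 0 t) =>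
    (hu.mono ht.2).hasDerivWithinAt_exp_smul_residual hd hc0 hs
  have hB : ∀ s ∈ Icc 0 t, HasDerivAt
      (fun s => Real.exp s * (gain p c (c ^ p) s * gain b c d s) * (v / 4))
      (Real.exp s * (gain p c (c ^ p) s * gain b c d s) * (v / 4) * (1 - (p + b) / (c + s)))
      s := fun s hs => by
    refine (((Real.hasDerivAt_exp s).mul ((hasDerivAt_gain hc0 hs.1).mul
      (hasDerivAt_gain hc0 hs.1))).mul_const (v / 4)).congr_deriv ?_
    simp only [Pi.mul_apply]
    ring
  have key := image_norm_le_of_norm_deriv_right_lt_deriv_boundary'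
    (fun s hs => (hderiv s hs).continuousWithinAt)
    (fun s hs => (hderiv s ⟨hs.1, hs.2.le⟩).mono_of_mem_nhdsWithin
      (Icc_mem_nhdsGE_of_mem hs)) (B := fun s =>
      Real.exp s * (gain p c (c ^ p) s * gain b c d s) * (v / 4)) ?_
    (fun s hs => (hB s hs).continuousAt.continuousWithinAt)
    (fun s hs => (hB s ⟨hs.1, hs.2.le⟩).hasDerivWithinAt) ?_ (x := t) ⟨ht.1, le_rfl⟩
  · rw [norm_smul, Real.norm_eq_abs, abs_of_pos (Real.exp_pos t), mul_assoc] at key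
    refine (le_of_mul_le_mul_left key (Real.exp_pos t)).trans_eq ?_
    ring
  · have hκ : gain p c (c ^ p) 0 = 1 := by
      rw [gain, add_zero, div_self (by positivity)]
    rw [hκ, Real.exp_zero, hu.1, one_smul]
    refine h0.trans ?_
    have := hVv 0 ⟨le_rfl, ht.1⟩
    have ha := gain_pos (b := b) hc0 hd0 le_rfl
    nlinarith
  · intro s hs heq
    have hs' : s ∈ Icc 0 t := ⟨hs.1, hs.2.le⟩
    have ha := gain_pos (b := b) hc0 hd0 hs.1
    have hct : 0 < c + s := by linarith [hs.1]
    have he := Real.exp_pos s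
    rw [norm_smul, Real.norm_eq_abs, abs_of_pos he, mul_assoc] at heq
    have hψ := mul_left_cancel₀ he.ne' heq
    have h1 := hF.mono.mul_norm_sub_le ha.le (u s) (regSol F (gain b c d s) g)
    rw [hF.regSol_spec ha, hψ] at h1
    have h2 : gain b c d s * ‖u s‖ ≤ gain b c d s * v * (1 + gain p c (c ^ p) s / 4) := by
      have h3 : ‖u s‖ ≤ ‖u s - regSol F (gain b c d s) g‖ + v := by
        linarith [norm_le_norm_sub_add (u s) (regSol F (gain b c d s) g), hVv s hs']
      have h4 := mul_le_mul_of_nonneg_left h3 ha.le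
      linarith
    have hκ1 := gain_normalized_le_one hp0 hc0 hs.1
    have hκ2 := le_gain_normalized_mul hp1 hc0 hs.1
    set κ := gain p c (c ^ p) s
    rw [norm_neg, norm_smul, Real.norm_eq_abs, abs_of_pos (by positivity)]
    calc _ = Real.exp s * (b / (c + s)) * (gain b c d s * ‖u s‖) := by ring
      _ ≤ Real.exp s * (b / (c + s)) * (gain b c d s * v * (1 + κ / 4)) := by gcongr
      _ = Real.exp s * gain b c d s * v / (4 * (c + s)) * (b * (4 + κ)) := by
        field_simp
      _ < Real.exp s * gain b c d s * v / (4 * (c + s)) * (κ * (c + s - (p + b))) := by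
        refine mul_lt_mul_of_pos_left ?_ (by positivity)
        nlinarith
      _ = _ := by field_simp

end Residual

/-! ### The discrepancy principle -/

section Stopping

/-- The first time at which a continuous function comes down to a given level. -/
lemma exists_first_eq {D : ℝ → ℝ} {T l : ℝ} (hT : 0 ≤ T) (hD : ContinuousOn D (Icc 0 T))
    (h0 : l < D 0) (h1 : D T < l) : ∃ s ∈ Ioo 0 T, D s = l ∧ ∀ t ∈ Ico 0 s, l < D t := by
  have hcpt : IsCompact (Icc 0 T ∩ D ⁻¹' Iic l) :=
    isCompact_Icc.of_isClosed_subset (hD.preimage_isClosed_of_isClosed isClosed_Icc isClosed_Iic)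
      inter_subset_left
  obtain ⟨s, ⟨hsT, hsl⟩, hmin⟩ := hcpt.exists_isLeast ⟨T, ⟨hT, le_rfl⟩, h1.le⟩
  have hsl : D s ≤ l := hsl
  have hbefore : ∀ t ∈ Ico 0 s, l < D t := fun t ht => by
    by_contra! hle
    exact absurd (hmin ⟨⟨ht.1, ht.2.le.trans hsT.2⟩, hle⟩) (not_le.2 ht.2)
  have hs : D s = l := by
    obtain ⟨r, hr, hrl⟩ := intermediate_value_Icc' hsT.1 (hD.mono (Icc_subset_Icc_right hsT.2))
      (⟨hsl, h0.le⟩ : l ∈ Icc (D s) (D 0))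
    have hsr : s ≤ r := hmin ⟨⟨hr.1, hr.2.trans hsT.2⟩, hrl.le⟩
    rwa [le_antisymm hsr hr.2]
  refine ⟨s, ⟨hsT.1.lt_of_ne ?_, hsT.2.lt_of_ne ?_⟩, hs, hbefore⟩
  · rintro rfl; exact h0.ne' hs
  · rintro rfl; exact h1.ne hs

lemma IsStoppingTimeDP.eq {H : Type*} [NormedAddCommGroup H] {F : H → H}
    {g : H} {l : ℝ} {u : ℝ → H} {s s' : ℝ} (hs : IsStoppingTimeDP F g l u s) (h : 0 ≤ s)
    (hs' : IsStoppingTimeDP F g l u s') (h' : 0 ≤ s') : s = s' := by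
  rcases lt_trichotomy s s' with hlt | heq | hlt
  · exact absurd hs.1 (hs'.2 s ⟨h, hlt⟩).ne'
  · exact heq
  · exact absurd hs'.1 (hs.2 s' ⟨h', hlt⟩).ne'

variable {H : Type*} [NormedAddCommGroup H] [InnerProductSpace ℝ H] [CompleteSpace H] {F : H → H}
  (hF : IsRegularizable F) {g f y : H}

include hF

lemma IsRegularizable.norm_image_regSol_sub {a : ℝ} (ha : 0 < a) (x : H) :
    ‖F (regSol F a x) - x‖ = a * ‖regSol F a x‖ := by
  nth_rewrite 2 [← hF.regSol_spec ha x]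
  rw [sub_add_cancel_left, norm_neg, norm_smul, Real.norm_eq_abs, abs_of_pos ha]

lemma IsRegularizable.norm_regSol_le_add {a δ : ℝ} (ha : 0 < a) (hy : F y = f)
    (hg : ‖g - f‖ ≤ δ) : ‖regSol F a g‖ ≤ ‖y‖ + δ / a := by
  have h1 : ‖regSol F a g - regSol F a f‖ ≤ δ / a := by
    rw [le_div_iff₀' ha]
    exact (hF.mul_norm_regSol_sub_le ha g f).trans hg
  linarith [norm_le_norm_sub_add (regSol F a g) (regSol F a f), hF.norm_regSol_le ha hy]

/-- The discrepancy of `v` differs from that of the regularized solution, which is `a ‖V‖`, by at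
most the residual of `v`. -/
lemma IsRegularizable.abs_norm_image_sub_sub_le {a : ℝ} (ha : 0 < a) (x v : H) :
    |‖F v - x‖ - a * ‖regSol F a x‖| ≤ ‖F v + a • v - x‖ := by
  rw [← hF.norm_image_regSol_sub ha]
  refine (abs_norm_sub_norm_le _ _).trans ?_
  have h := hF.mono.norm_image_sub_le ha.le v (regSol F a x)
  rwa [hF.regSol_spec ha, ← sub_sub_sub_cancel_right _ _ x] at h

lemma IsRegularizable.norm_sub_regSol_le {a K : ℝ} (ha : 0 < a) {x v : H}
    (h : ‖F v + a • v - x‖ ≤ K * (a * ‖regSol F a x‖)) :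
    ‖v - regSol F a x‖ ≤ K * ‖regSol F a x‖ := by
  have h1 := hF.mono.mul_norm_sub_le ha.le v (regSol F a x)
  rw [hF.regSol_spec ha] at h1
  refine le_of_mul_le_mul_left ?_ ha
  linarith

variable {b c d δ l : ℝ} {u₀ : H}

/-- The discrepancy at time `T` is at most `(1 + κ T / 4) * (a T * ‖y‖ + δ)`, where
`κ T = (c / (c + T)) ^ p`. This tends to `δ`, so the level `l > δ` is reached. -/
lemma IsRegularizable.exists_stopping (hd : Differentiable ℝ F) (hb : 0 < b) (hc : 6 * b < c)
    (hd0 : 0 < d) (hy : F y = f) (hg : ‖g - f‖ ≤ δ) (hl : δ < l)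
    (hV : regSol F (gain b c d 0) g ≠ 0)
    (h0 : ‖F u₀ + gain b c d 0 • u₀ - g‖
      ≤ 1 / 4 * gain b c d 0 * ‖regSol F (gain b c d 0) g‖) (hu₀ : l < ‖F u₀ - g‖) :
    ∃ (T : ℝ) (u : ℝ → H) (s : ℝ), IsDSMSolution F (gain b c d) g u₀ T u ∧ s ∈ Ioo 0 T ∧
      IsStoppingTimeDP F g l u s := by
  have hc0 : 0 < c := by linarith
  set p : ℝ := min 1 ((c - 6 * b) / 2) with hp
  have hp0 : 0 < p := lt_min one_pos (by linarith)
  have hpc : 6 * b + p < c := by linarith [min_le_right (1 : ℝ) ((c - 6 * b) / 2)]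
  have hlim : Tendsto (fun T => (1 + 1 / 4 * gain p c (c ^ p) T) * (gain b c d T * ‖y‖ + δ))
      atTop (𝓝 δ) := by
    have h1 := (((tendsto_gain_atTop (c := c) (d := c ^ p) hp0).const_mul (1 / 4)).const_add 1).mul
      (((tendsto_gain_atTop (c := c) (d := d) hb).mul_const ‖y‖).add_const δ)
    simpa using h1
  obtain ⟨T, hTl, hT⟩ := ((hlim.eventually_lt_const hl).and (eventually_gt_atTop 0)).exists
  obtain ⟨u, hu⟩ := hF.exists_isDSMSolution hd hb hc0 (by linarith) hd0 g u₀ hT.le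
  have hD : ContinuousOn (fun t => ‖F (u t) - g‖) (Icc 0 T) :=
    ((hd.continuous.comp_continuousOn hu.continuousOn).sub continuousOn_const).norm
  have hDT : ‖F (u T) - g‖ < l := by
    have ha := gain_pos (b := b) hc0 hd0 hT.le
    have hκ : 0 < gain p c (c ^ p) T := gain_pos hc0 (by positivity) hT.le
    have h1 := hu.norm_residual_le hF hd hb hp0.le (min_le_left _ _) hpc hd0 hV h0
      ⟨hT.le, le_rfl⟩
    have h2 := (abs_le.1 (hF.abs_norm_image_sub_sub_le ha g (u T))).2
    have h3 : gain b c d T * ‖regSol F (gain b c d T) g‖ ≤ gain b c d T * ‖y‖ + δ := by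
      have h4 := mul_le_mul_of_nonneg_left (hF.norm_regSol_le_add ha hy hg) ha.le
      rwa [mul_add, mul_div_cancel₀ _ ha.ne'] at h4
    refine lt_of_le_of_lt ?_ hTl
    calc ‖F (u T) - g‖ ≤ (1 + 1 / 4 * gain p c (c ^ p) T)
          * (gain b c d T * ‖regSol F (gain b c d T) g‖) := by linarith
      _ ≤ _ := by gcongr
  obtain ⟨s, hs, hsl, hbefore⟩ := exists_first_eq hT.le hD (by simpa [hu.1] using hu₀) hDT
  exact ⟨T, u, s, hu, hs, hsl, hbefore⟩

end Stopping

/-! ### Convergence of the method -/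

theorem theorem3p1 {H : Type*} [NormedAddCommGroup H] [InnerProductSpace ℝ H] [CompleteSpace H]
    (F : H → H) (hmono : IsMonotoneOperator F) (hdiff : TwiceFrechetDifferentiable F)
    (M : ℕ → H → ℝ → ℝ) (hM : DerivativesBoundedOnBalls F M)
    (f y : H) (hy : IsMinimalNormSolution F f y) (hy0 : y ≠ 0)
    (b c d : ℝ) (hb0 : 0 < b) (hb1 : b ≤ 1) (hc0 : 0 < c) (hc : 6 * b < c) (hd : 0 < d)
    (C₁ ζ : ℝ) (hC₁ : 1 < C₁) (hζ0 : 0 < ζ) (hζ1 : ζ ≤ 1)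
    (δ₀ : ℝ) (hδ₀ : 0 < δ₀) (hδ₀1 : δ₀ ≤ 1)
    (fδ u₀ : ℝ → H)
    (hnoise : ∀ δ ∈ Ioo 0 δ₀, ‖fδ δ - f‖ ≤ δ)
    (hlarge : ∀ δ ∈ Ioo 0 δ₀, ∃ R > 0, ∃ l > 0,
      LargeGain F (gain b c d) (fδ δ) (M 2 (u₀ δ) R / 2)
        (‖y‖ * (1 + 1 / ((C₁ + 1) / 2 - 1))) l)
    (hclose : ∀ δ ∈ Ioo 0 δ₀, InitialPointClose F (gain b c d) (fδ δ) (u₀ δ))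
    (hinit : ∀ δ ∈ Ioo 0 δ₀, C₁ * δ ^ ζ < ‖F (u₀ δ) - fδ δ‖) :
    ∃ (T : ℝ → ℝ) (u : ℝ → ℝ → H) (tδ : ℝ → ℝ),
      (∀ δ ∈ Ioo 0 δ₀,
        0 < T δ ∧
        IsDSMSolution F (gain b c d) (fδ δ) (u₀ δ) (T δ) (u δ) ∧
        (∀ (S : ℝ) (v : ℝ → H), IsDSMSolution F (gain b c d) (fδ δ) (u₀ δ) S v →
          EqOn v (u δ) (Icc 0 (min S (T δ)))) ∧
        tδ δ ∈ Ioo 0 (T δ) ∧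
        IsStoppingTimeDP F (fδ δ) (C₁ * δ ^ ζ) (u δ) (tδ δ) ∧
        (∀ s ∈ Ioo 0 (T δ), IsStoppingTimeDP F (fδ δ) (C₁ * δ ^ ζ) (u δ) s → s = tδ δ)) ∧
      Tendsto T (𝓝[>] 0) atTop ∧
      Tendsto tδ (𝓝[>] 0) atTop ∧
      (ζ < 1 → Tendsto (fun δ => u δ (tδ δ)) (𝓝[>] 0) (𝓝 y)) := by
  have hF : IsRegularizable F := ⟨hmono, hM.lipschitzOnBalls hdiff.1⟩
  have hFd := hdiff.1
  set a := gain b c d with ha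
  have hapos : ∀ {t}, 0 ≤ t → 0 < a t := fun ht => gain_pos hc0 hd ht
  have hpow : ∀ δ ∈ Ioo 0 δ₀, δ < C₁ * δ ^ ζ := fun δ hδ => by
    have h1 : δ ^ (1 : ℝ) ≤ δ ^ ζ :=
      Real.rpow_le_rpow_of_exponent_ge hδ.1 (hδ.2.le.trans hδ₀1) hζ1
    rw [Real.rpow_one] at h1
    nlinarith [hδ.1]
  have hres₀ : ∀ δ ∈ Ioo 0 δ₀, ‖F (u₀ δ) + a 0 • u₀ δ - fδ δ‖
      ≤ 1 / 4 * a 0 * ‖regSol F (a 0) (fδ δ)‖ := fun δ hδ =>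
    (hclose δ hδ _ (sub_eq_zero.2 (hF.regSol_spec (hapos le_rfl) _))).2
  -- If the regularized solution vanished, then `u₀ δ` would be `0`, with zero discrepancy.
  have hVne : ∀ δ ∈ Ioo 0 δ₀, regSol F (a 0) (fδ δ) ≠ 0 := fun δ hδ h0 => by
    have h1 := hres₀ δ hδ
    rw [h0, norm_zero, mul_zero, norm_le_zero_iff, sub_eq_zero,
      ← hF.eq_regSol_iff (hapos le_rfl), h0] at h1
    have h2 := hF.regSol_spec (hapos le_rfl) (fδ δ)
    rw [h0, smul_zero, add_zero] at h2
    have h3 := hinit δ hδ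
    rw [h1, h2, sub_self, norm_zero] at h3
    linarith [hpow δ hδ, hδ.1]
  have hex : ∀ δ, ∃ (T : ℝ) (u : ℝ → H) (s : ℝ), δ ∈ Ioo 0 δ₀ →
      IsDSMSolution F a (fδ δ) (u₀ δ) T u ∧ s ∈ Ioo 0 T ∧
        IsStoppingTimeDP F (fδ δ) (C₁ * δ ^ ζ) u s := fun δ => by
    by_cases hδ : δ ∈ Ioo 0 δ₀
    · obtain ⟨T, u, s, h⟩ := hF.exists_stopping hFd hb0 hc hd hy.1 (hnoise δ hδ) (hpow δ hδ)
        (hVne δ hδ) (hres₀ δ hδ) (hinit δ hδ)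
      exact ⟨T, u, s, fun _ => h⟩
    · exact ⟨0, 0, 0, fun h => absurd h hδ⟩
  choose T u s hs using hex
  have hev : ∀ᶠ δ in 𝓝[>] (0 : ℝ), δ ∈ Ioo 0 δ₀ := Ioo_mem_nhdsGT hδ₀
  have hidlim : Tendsto (fun δ : ℝ => δ) (𝓝[>] 0) (𝓝 0) := nhdsWithin_le_nhds
  have hspos : ∀ {δ}, δ ∈ Ioo 0 δ₀ → 0 < s δ := fun hδ => (hs _ hδ).2.1.1
  -- Consequences of the barrier estimate at the stopping time.
  set p : ℝ := min 1 ((c - 6 * b) / 2) with hp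
  have hp0 : 0 < p := lt_min one_pos (by linarith)
  have hpc : 6 * b + p < c := by linarith [min_le_right (1 : ℝ) ((c - 6 * b) / 2)]
  set κ := gain p c (c ^ p) with hκ
  have hres : ∀ δ ∈ Ioo 0 δ₀, ‖F (u δ (s δ)) + a (s δ) • u δ (s δ) - fδ δ‖
      ≤ 1 / 4 * κ (s δ) * (a (s δ) * ‖regSol F (a (s δ)) (fδ δ)‖) := fun δ hδ =>
    (hs δ hδ).1.norm_residual_le hF hFd hb0 hp0.le (min_le_left _ _) hpc hd (hVne δ hδ)
      (hres₀ δ hδ) ⟨(hs δ hδ).2.1.1.le, (hs δ hδ).2.1.2.le⟩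
  have hdisc : ∀ δ ∈ Ioo 0 δ₀,
      |C₁ * δ ^ ζ - a (s δ) * ‖regSol F (a (s δ)) (fδ δ)‖|
        ≤ 1 / 4 * (a (s δ) * ‖regSol F (a (s δ)) (fδ δ)‖) := fun δ hδ => by
    have has := hapos (hspos hδ).le
    have h1 := hF.abs_norm_image_sub_sub_le has (fδ δ) (u δ (s δ))
    rw [(hs δ hδ).2.2.1] at h1
    refine (h1.trans (hres δ hδ)).trans ?_
    have h2 : κ (s δ) ≤ 1 := gain_normalized_le_one hp0.le hc0 (hspos hδ).le
    gcongr
    linarith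
  have hζlim : Tendsto (fun δ : ℝ => δ ^ ζ) (𝓝[>] 0) (𝓝 0) := by
    simpa [hζ0.ne'] using hidlim.rpow_const (Or.inr hζ0.le)
  -- The regularized solutions at time `0` stay away from `0`, which forces `a (s δ) → 0`.
  have hV₀ : 0 < ‖regSol F (a 0) f‖ := by
    refine norm_pos_iff.2 fun h0 => hy0 ?_
    have h1 := hF.regSol_spec (hapos le_rfl) f
    rw [h0, smul_zero, add_zero] at h1
    simpa using hy.2 0 h1
  have haslim : Tendsto (fun δ => a (s δ)) (𝓝[>] 0) (𝓝 0) := by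
    have hup : Tendsto (fun δ : ℝ => 8 / (3 * ‖regSol F (a 0) f‖) * (C₁ * δ ^ ζ)) (𝓝[>] 0)
        (𝓝 0) := by
      simpa using (hζlim.const_mul C₁).const_mul (8 / (3 * ‖regSol F (a 0) f‖))
    have hsmall : ∀ᶠ δ in 𝓝[>] (0 : ℝ), δ < a 0 * (‖regSol F (a 0) f‖ / 2) :=
      hidlim.eventually_lt_const (by have := hapos le_rfl; positivity)
    refine squeeze_zero' ?_ ?_ hup
    · filter_upwards [hev] with δ hδ using (hapos (hspos hδ).le).le
    filter_upwards [hev, hsmall] with δ hδ hδs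
    have has := hapos (hspos hδ).le
    have h1 : ‖regSol F (a 0) f‖ / 2 ≤ ‖regSol F (a (s δ)) (fδ δ)‖ := by
      have h2 := (hF.mul_norm_regSol_sub_le (hapos le_rfl) (fδ δ) f).trans (hnoise δ hδ)
      have h3 : ‖regSol F (a 0) (fδ δ) - regSol F (a 0) f‖ < ‖regSol F (a 0) f‖ / 2 :=
        lt_of_mul_lt_mul_left (h2.trans_lt hδs) (hapos le_rfl).le
      have h4 := hF.norm_regSol_anti has (gain_anti hb0.le hc0 hd le_rfl (hspos hδ).le) (fδ δ)
      rw [norm_sub_rev] at h3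
      linarith [norm_le_norm_sub_add (regSol F (a 0) f) (regSol F (a 0) (fδ δ))]
    have h5 := (abs_le.1 (hdisc δ hδ)).1
    have h6 := mul_le_mul_of_nonneg_left h1 has.le
    rw [div_mul_eq_mul_div, le_div_iff₀ (by positivity)]
    linarith
  have hslim : Tendsto s (𝓝[>] 0) atTop := by
    refine tendsto_atTop.2 fun N => ?_
    filter_upwards [hev, haslim.eventually_lt_const (hapos (le_max_right N 0))] with δ hδ hlt
    by_contra! hN
    exact absurd (gain_anti hb0.le hc0 hd (hspos hδ).le (hN.le.trans (le_max_left _ _)))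
      (not_le.2 hlt)
  refine ⟨T, u, s, fun δ hδ => ?_, ?_, hslim, fun hζ => ?_⟩
  · obtain ⟨hu, hsT, hst⟩ := hs δ hδ
    refine ⟨hsT.1.trans hsT.2, hu, fun S v hv => ?_, hsT, hst,
      fun s' hs' hst' => hst'.eq hs'.1.le hst hsT.1.le⟩
    exact (hv.mono (min_le_left _ _)).eqOn hmono hFd hb0 hc0 hd (hu.mono (min_le_right _ _))
  · refine tendsto_atTop_mono' _ ?_ hslim
    filter_upwards [hev] with δ hδ using (hs δ hδ).2.1.2.le
  -- The discrepancy is at most `5 / 4 * (a (s δ) * ‖y‖ + δ)`, and `δ` is negligible against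
  -- `δ ^ ζ`; so `a (s δ)` is at least a multiple of `δ ^ ζ`.
  have hratio : Tendsto (fun δ => δ / a (s δ)) (𝓝[>] 0) (𝓝 0) := by
    have hpl : Tendsto (fun δ : ℝ => δ ^ (1 - ζ)) (𝓝[>] 0) (𝓝 0) := by
      have h1 : 1 - ζ ≠ 0 := by linarith
      simpa [h1] using hidlim.rpow_const (p := 1 - ζ) (Or.inr (by linarith))
    have hup : Tendsto (fun δ : ℝ => 5 / 2 * ‖y‖ * δ ^ (1 - ζ)) (𝓝[>] 0) (𝓝 0) := by
      simpa using hpl.const_mul (5 / 2 * ‖y‖)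
    have hsmall : ∀ᶠ δ in 𝓝[>] (0 : ℝ), δ ^ (1 - ζ) < 2 / 5 :=
      hpl.eventually_lt_const (by norm_num)
    refine squeeze_zero' ?_ ?_ hup
    · filter_upwards [hev] with δ hδ using div_nonneg hδ.1.le (hapos (hspos hδ).le).le
    filter_upwards [hev, hsmall] with δ hδ hδs
    have has := hapos (hspos hδ).le
    have h1 := (abs_le.1 (hdisc δ hδ)).2
    have h2 := mul_le_mul_of_nonneg_left
      (hF.norm_regSol_le_add has hy.1 (hnoise δ hδ)) has.le
    rw [mul_add, mul_div_cancel₀ _ has.ne'] at h2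
    have hq0 : 0 < δ ^ (1 - ζ) := Real.rpow_pos_of_pos hδ.1 _
    have hz0 : 0 < δ ^ ζ := Real.rpow_pos_of_pos hδ.1 _
    have hfac : δ = δ ^ (1 - ζ) * δ ^ ζ := by
      rw [← Real.rpow_add hδ.1, sub_add_cancel, Real.rpow_one]
    have h3 : δ ^ ζ ≤ C₁ * δ ^ ζ := by nlinarith
    have h4 : δ ≤ 2 / 5 * δ ^ ζ := by
      calc δ = δ ^ (1 - ζ) * δ ^ ζ := hfac
        _ ≤ 2 / 5 * δ ^ ζ := by gcongr
    have h5 : δ ^ ζ ≤ 5 / 2 * ‖y‖ * a (s δ) := by linarith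
    rw [div_le_iff₀ has]
    calc δ = δ ^ (1 - ζ) * δ ^ ζ := hfac
      _ ≤ δ ^ (1 - ζ) * (5 / 2 * ‖y‖ * a (s δ)) := by gcongr
      _ = _ := by ring
  have hκlim : Tendsto (fun δ => κ (s δ)) (𝓝[>] 0) (𝓝 0) := (tendsto_gain_atTop hp0).comp hslim
  have hVlim : Tendsto (fun δ => regSol F (a (s δ)) f) (𝓝[>] 0) (𝓝 y) :=
    (hF.tendsto_regSol hFd.continuous hy).comp (tendsto_nhdsWithin_iff.2 ⟨haslim, by
      filter_upwards [hev] with δ hδ using hapos (hspos hδ).le⟩)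
  rw [tendsto_iff_norm_sub_tendsto_zero] at hVlim ⊢
  have hup : Tendsto (fun δ => 1 / 4 * κ (s δ) * (‖y‖ + δ / a (s δ)) + δ / a (s δ)
      + ‖regSol F (a (s δ)) f - y‖) (𝓝[>] 0) (𝓝 0) := by
    simpa only [mul_zero, zero_mul, add_zero] using
      (((hκlim.const_mul (1 / 4)).mul (hratio.const_add ‖y‖)).add hratio).add hVlim
  refine squeeze_zero' (Eventually.of_forall fun _ => norm_nonneg _) ?_ hup
  filter_upwards [hev] with δ hδ
  have has := hapos (hspos hδ).le
  have hκ0 : 0 < κ (s δ) := gain_pos hc0 (by positivity) (hspos hδ).le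
  have h1 := hF.norm_sub_regSol_le has (hres δ hδ)
  have h2 : 1 / 4 * κ (s δ) * ‖regSol F (a (s δ)) (fδ δ)‖
      ≤ 1 / 4 * κ (s δ) * (‖y‖ + δ / a (s δ)) := by
    gcongr
    exact hF.norm_regSol_le_add has hy.1 (hnoise δ hδ)
  have h3 : ‖regSol F (a (s δ)) (fδ δ) - regSol F (a (s δ)) f‖ ≤ δ / a (s δ) := by
    rw [le_div_iff₀' has]
    exact (hF.mul_norm_regSol_sub_le has _ _).trans (hnoise δ hδ)
  linarith [norm_sub_le_norm_sub_add_norm_sub (u δ (s δ)) (regSol F (a (s δ)) (fδ δ)) y,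
    norm_sub_le_norm_sub_add_norm_sub (regSol F (a (s δ)) (fδ δ)) (regSol F (a (s δ)) f) y]
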